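/- Let $X=(X_1,\ldots,X_d)$ be a random vector with the elliptical distribution $E(\mu,K^{-1})$, where $\mu\in\mathbb{R}^d$ and $K\in\mathbb{R}^{d\times d}$ is symmetric positive definite; that is, the characteristic function of $X$ has the form $t\mapsto \phi(t^{T}K^{-1}t)\exp(i\mu^{T}t)$ for some $\phi:[0,\infty)\to\mathbb{R}$. Assume that $\mathbb{E}\|X\|^2<\infty$ and that $X$ is not almost surely equal to $\mu$ (equivalently, in the stochastic representation $X=\mu+\xi K^{-1/2}U$, with $U$ uniform on the unit sphere, $\xi\ge 0$ and $\xi$ independent of $U$, one has $0<\mathbb{E}\xi^2<\infty$). Let $i\neq j$ and let $X_{(ij)}$ be the vector of the remaining $d-2$ coordinates, obtained by removing $X_i$ and $X_j$ from $X$. Then $K_{ij}=0$ if and only if, for every measurable function $g:\mathbb{R}\to\mathbb{R}$ for which the conditional covariance $\mathrm{cov}(g(X_i),X_j\mid X_{(ij)})$ exists almost surely, one has $$\mathrm{cov}\bigl(g(X_i),X_j\mid X_{(ij)}\bigr)=0\quad\text{almost surely.}$$ Here $\mathrm{cov}(g(X_i),X_j\mid X_{(ij)})$ is the covariance under the regular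 conditional distribution of $(g(X_i),X_j)$ given $X_{(ij)}$, and it exists when $g(X_i)$, $X_j$ and $g(X_i)X_j$ are integrable under that conditional distribution. -/

import Mathlib

open MeasureTheory ProbabilityTheory

/-- The random vector `X` has the elliptical distribution `E(m, S)`: `S` is positive semi-definite
and the characteristic function of `X` is `t ↦ φ(tᵀ S t) exp(i mᵀ t)` for some real-valued `φ`
(since `tᵀ S t ≥ 0`, only the values of `φ` on `[0, ∞)` matter). -/
def IsElliptical {Ω : Type*} [MeasurableSpace Ω] (P : Measure Ω) {d : ℕ}
    (X : Ω → EuclideanSpace ℝ (Fin d)) (m : EuclideanSpace ℝ (Fin d))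
    (S : Matrix (Fin d) (Fin d) ℝ) : Prop :=
  AEMeasurable X P ∧ S.PosSemidef ∧
    ∃ φ : ℝ → ℝ, ∀ t : EuclideanSpace ℝ (Fin d),
      charFun (P.map X) t =
        (φ (∑ k, ∑ l, t k * S k l * t l) : ℂ) * Complex.exp (Complex.I * (∑ k, m k * t k : ℝ))

/-- The subvector `X_(ij)` of `X`, obtained by removing the coordinates `i` and `j`. -/
def dropPair {Ω : Type*} {d : ℕ} (X : Ω → EuclideanSpace ℝ (Fin d)) (i j : Fin d) :
    Ω → ({k : Fin d // k ≠ i ∧ k ≠ j} → ℝ) :=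
  fun ω k => X ω k

/-- The regular conditional distribution of the pair `(U, W)` given `C`, as a random measure
on `ℝ × ℝ`. -/
noncomputable def condPairLaw {Ω E : Type*} [MeasurableSpace Ω] [MeasurableSpace E]
    (P : Measure Ω) [IsFiniteMeasure P] (U W : Ω → ℝ) (C : Ω → E) (ω : Ω) : Measure (ℝ × ℝ) :=
  condDistrib (fun ω' => (U ω', W ω')) C P (C ω)

/-- The conditional covariance `cov(U, W | C)` exists at `ω`: under the conditional distribution
of `(U, W)` given `C`, both variables and their product are integrable. -/
def CondCovExistsAt {Ω E : Type*} [MeasurableSpace Ω] [MeasurableSpace E]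
    (P : Measure Ω) [IsFiniteMeasure P] (U W : Ω → ℝ) (C : Ω → E) (ω : Ω) : Prop :=
  Integrable (fun p : ℝ × ℝ => p.1) (condPairLaw P U W C ω) ∧
    Integrable (fun p : ℝ × ℝ => p.2) (condPairLaw P U W C ω) ∧
    Integrable (fun p : ℝ × ℝ => p.1 * p.2) (condPairLaw P U W C ω)

/-- The conditional covariance `cov(U, W | C)`, a random variable: the covariance of the two
coordinates under the conditional distribution of `(U, W)` given `C`. -/
noncomputable def condCov {Ω E : Type*} [MeasurableSpace Ω] [MeasurableSpace E]
    (P : Measure Ω) [IsFiniteMeasure P] (U W : Ω → ℝ) (C : Ω → E) (ω : Ω) : ℝ :=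
  covariance (fun p : ℝ × ℝ => p.1) (fun p : ℝ × ℝ => p.2) (condPairLaw P U W C ω)

/-!
The proof rests on one symmetry. For each `k`, the affine reflection
`T_k x = x - (2 / K_kk) (K (x - m))_k e_k` fixes `m` and is orthogonal for the inner product
`xᵀ K y`, so its transpose preserves `tᵀ K⁻¹ t`, hence the characteristic function and the law of
`X` (`IsElliptical.map_axisReflection`). It moves the `k`-th coordinate only.

Since `T_j` fixes `X_i` and `X_(ij)`, it acts on almost every conditional law of `(X_i, X_j)` given
`X_(ij)`, as `(u, w) ↦ (u, l - b u - w)` with `b = 2 K_ij / K_jj` and `l` depending on `X_(ij)` only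
(`IsElliptical.exists_map_condPairLaw_eq`).

If `K_ij = 0`, then `b = 0`, and the same holds for `(g(X_i), X_j)`. The conditional covariance
thus equals its own negative.

If `K_ij ≠ 0`, take `g = id`. The symmetry gives `2 cov(X_i, X_j | X_(ij)) = -b Var(X_i | X_(ij))`.
Were this zero almost surely, `X_i` would be a function of `X_(ij)`. As `T_i` changes `X_i` but not
`X_(ij)`, this forces `(K (X - m))_i = 0` almost surely. The characteristic function along the
`i`-th row of `K` then shows `φ = 1` on `[0, ∞)`, that is `X = m` almost surely
(`IsElliptical.ae_eq_of_coord_ae_eq_comp`).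
-/

/-! ### Reflections along the coordinate axes -/

section Reflection

variable {d : ℕ} {K : Matrix (Fin d) (Fin d) ℝ}

/-- The reflection of `ℝᵈ` across the hyperplane through `m` that is orthogonal to the `k`-th basis
vector for the inner product `(x, y) ↦ xᵀ K y`. It changes no coordinate other than the `k`-th. -/
noncomputable def axisReflection (K : Matrix (Fin d) (Fin d) ℝ) (m : EuclideanSpace ℝ (Fin d))
    (k : Fin d) (x : EuclideanSpace ℝ (Fin d)) : EuclideanSpace ℝ (Fin d) :=
  x - (2 / K k k * ∑ l, K k l * (x l - m l)) • EuclideanSpace.single k (1 : ℝ)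

lemma axisReflection_apply_self (m x : EuclideanSpace ℝ (Fin d)) (k : Fin d) :
    axisReflection K m k x k = x k - 2 / K k k * ∑ l, K k l * (x l - m l) := by
  simp [axisReflection]

lemma axisReflection_apply_of_ne (m x : EuclideanSpace ℝ (Fin d)) {k l : Fin d} (h : l ≠ k) :
    axisReflection K m k x l = x l := by
  simp [axisReflection, h]

@[fun_prop]
lemma measurable_axisReflection (m : EuclideanSpace ℝ (Fin d)) (k : Fin d) :
    Measurable (axisReflection K m k) := by
  have : Continuous (axisReflection K m k) := by
    unfold axisReflection
    fun_prop
  exact this.measurable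

open Matrix in
/-- The form `tᵀ K⁻¹ t` along the direction of the `k`-th row of `K`, to which `K⁻¹` is dual. -/
lemma quadForm_inv_sub_smul_row (hK : K.PosDef) (t : Fin d → ℝ) (c : ℝ) (k : Fin d) :
    ∑ a, ∑ b, (t a - c * K k a) * K⁻¹ a b * (t b - c * K k b) =
      (∑ a, ∑ b, t a * K⁻¹ a b * t b) - 2 * c * t k + c ^ 2 * K k k := by
  have key (u v : Fin d → ℝ) :
      ∑ a, ∑ b, u a * K⁻¹ a b * v b = u ⬝ᵥ (K⁻¹ *ᵥ v) := by
    simp only [dotProduct, mulVec, Finset.mul_sum, mul_assoc]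
  have hrow : K k = K *ᵥ Pi.single k 1 := by
    ext a
    simpa using (hK.isHermitian.apply a k)
  have hdet : IsUnit K.det := (Matrix.isUnit_iff_isUnit_det K).1 hK.isUnit
  have h1 : K⁻¹ *ᵥ K k = Pi.single k 1 := by
    rw [hrow, mulVec_mulVec, nonsing_inv_mul _ hdet, one_mulVec]
  have hsymm : (K⁻¹)ᵀ = K⁻¹ := by
    simpa [Matrix.IsHermitian, conjTranspose_eq_transpose_of_trivial] using hK.inv.isHermitian
  have h2 : K k ⬝ᵥ (K⁻¹ *ᵥ t) = t k := by
    rw [dotProduct_mulVec, ← mulVec_transpose, hsymm, h1]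
    simp
  have := key (t - c • K k) (t - c • K k)
  simp only [Pi.sub_apply, Pi.smul_apply, smul_eq_mul] at this
  rw [this, key, mulVec_sub, mulVec_smul, h1]
  simp only [sub_dotProduct, dotProduct_sub, smul_dotProduct, dotProduct_smul, h2, smul_eq_mul,
    dotProduct_single_one, Pi.sub_apply, Pi.smul_apply]
  ring

end Reflection

/-! ### Symmetry and nondegeneracy of elliptical laws -/

section Elliptical

variable {Ω : Type*} [MeasurableSpace Ω] {P : Measure Ω} [IsProbabilityMeasure P]
  {d : ℕ} {X : Ω → EuclideanSpace ℝ (Fin d)} {m : EuclideanSpace ℝ (Fin d)}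
  {K : Matrix (Fin d) (Fin d) ℝ}

/-- Reflections that preserve `tᵀ K⁻¹ t` leave the characteristic function, hence the law, of `X`
unchanged. -/
lemma IsElliptical.map_axisReflection (hX : IsElliptical P X m K⁻¹) (hK : K.PosDef) (k : Fin d) :
    (P.map X).map (axisReflection K m k) = P.map X := by
  obtain ⟨hXm, -, φ, hφ⟩ := hX
  have : IsProbabilityMeasure (P.map X) := Measure.isProbabilityMeasure_map hXm
  have hkk : K k k ≠ 0 := hK.diag_pos.ne'
  refine Measure.ext_of_charFun ?_
  ext t
  -- the adjoint of the linear part of the reflection sends `t` to `t - c • r`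
  set c : ℝ := 2 * t k / K k k with hc
  set r : EuclideanSpace ℝ (Fin d) := WithLp.toLp 2 (K k) with hr
  have hinner (x : EuclideanSpace ℝ (Fin d)) :
      inner ℝ (axisReflection K m k x) t = inner ℝ x (t - c • r) + c * ∑ l, m l * K k l := by
    have hsum : ∑ l, K k l * (x l - m l) = inner ℝ x r - ∑ l, m l * K k l := by
      simp [PiLp.inner_apply, hr, mul_sub, Finset.sum_sub_distrib, mul_comm]
    rw [axisReflection, hsum, inner_sub_left, inner_sub_right, real_inner_smul_left,
      real_inner_smul_right, EuclideanSpace.inner_single_left]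
    simp only [map_one, hc]
    field_simp
    ring
  have hq := quadForm_inv_sub_smul_row hK t c k
  have hz : -(2 * c * t k) + c ^ 2 * K k k = 0 := by rw [hc]; field_simp; ring
  rw [charFun_apply, integral_map (by fun_prop) (by fun_prop)]
  simp_rw [hinner]
  push_cast
  simp_rw [add_mul, Complex.exp_add]
  rw [integral_mul_const, ← charFun_apply, hφ, hφ, mul_assoc, ← Complex.exp_add]
  congr 3
  · simp only [PiLp.sub_apply, PiLp.smul_apply, smul_eq_mul, hr]
    rw [hq]
    linarith
  · simp only [PiLp.sub_apply, PiLp.smul_apply, smul_eq_mul, hr, mul_sub, Finset.sum_sub_distrib,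
      mul_left_comm _ c, ← Finset.mul_sum]
    push_cast
    ring

/-- If a single linear form of `X`, given by a row of `K`, is deterministic, then `φ = 1` on
`[0, ∞)`, so that `X` itself is deterministic. -/
lemma IsElliptical.ae_eq_of_row_eq_zero (hX : IsElliptical P X m K⁻¹) (hK : K.PosDef) (k : Fin d)
    (h : ∀ᵐ x ∂(P.map X), ∑ l, K k l * (x l - m l) = 0) : ∀ᵐ ω ∂P, X ω = m := by
  obtain ⟨hXm, hS, φ, hφ⟩ := hX
  have : IsProbabilityMeasure (P.map X) := Measure.isProbabilityMeasure_map hXm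
  have hkk : 0 < K k k := hK.diag_pos
  set r : EuclideanSpace ℝ (Fin d) := WithLp.toLp 2 (K k) with hr
  have hφ1 (s : ℝ) : φ (s ^ 2 * K k k) = 1 := by
    have h1 : charFun (P.map X) (s • r) =
        Complex.exp (Complex.I * (∑ l, m l * (s • r) l : ℝ)) := by
      rw [charFun_apply]
      have : ∀ᵐ x ∂(P.map X), Complex.exp (inner ℝ x (s • r) * Complex.I) =
          Complex.exp (Complex.I * (∑ l, m l * (s • r) l : ℝ)) := by
        filter_upwards [h] with x hx
        have hx' : inner ℝ x (s • r) = ∑ l, m l * (s • r) l := by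
          rw [← sub_eq_zero, ← mul_zero s, ← hx, PiLp.inner_apply, ← Finset.sum_sub_distrib,
            Finset.mul_sum]
          refine Finset.sum_congr rfl fun l _ => ?_
          simp [hr]
          ring
        rw [hx', mul_comm]
      rw [integral_congr_ae this]
      simp
    have hq := quadForm_inv_sub_smul_row hK 0 (-s) k
    simp only [Pi.zero_apply, zero_sub, neg_mul, neg_neg, zero_mul, mul_zero,
      Finset.sum_const_zero, neg_zero, zero_add, even_two, Even.neg_pow] at hq
    rw [hφ] at h1
    have h2 := mul_right_cancel₀ (Complex.exp_ne_zero _) (h1.trans (one_mul _).symm)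
    simp only [PiLp.smul_apply, smul_eq_mul, hr, hq] at h2
    exact_mod_cast h2
  have hdirac : P.map X = Measure.dirac m := by
    refine Measure.ext_of_charFun ?_
    ext t
    have hq : 0 ≤ ∑ a, ∑ b, t a * K⁻¹ a b * t b := by
      have := hS.dotProduct_mulVec_nonneg (t : Fin d → ℝ)
      simpa [dotProduct, Matrix.mulVec, Finset.mul_sum, mul_assoc] using this
    -- every value `tᵀ K⁻¹ t` is of the form `s² K_kk`
    have h1 := hφ1 (Real.sqrt ((∑ a, ∑ b, t a * K⁻¹ a b * t b) / K k k))
    rw [Real.sq_sqrt (by positivity), div_mul_cancel₀ _ hkk.ne'] at h1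
    rw [hφ, h1, charFun_dirac, Complex.ofReal_one, one_mul, mul_comm Complex.I, PiLp.inner_apply]
    simp [mul_comm]
  refine ae_of_ae_map (p := fun x => x = m) hXm ?_
  rw [hdirac, ae_dirac_eq]
  exact rfl

end Elliptical

/-! ### Conditional distributions -/

section Conditional

variable {Ω E G : Type*} [MeasurableSpace Ω] [MeasurableSpace E] [MeasurableSpace G]
  [StandardBorelSpace G] [Nonempty G] {P : Measure Ω} [IsProbabilityMeasure P]
  {C : Ω → E} {Y : Ω → G}

/-- A fibrewise transformation that preserves the joint law of `(C, Y)` preserves almost every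
conditional law of `Y` given `C`. -/
lemma map_condDistrib_eq_of_map_eq (hC : AEMeasurable C P) (hY : AEMeasurable Y P)
    {F : E × G → G} (hF : Measurable F)
    (h : P.map (fun ω => (C ω, F (C ω, Y ω))) = P.map (fun ω => (C ω, Y ω))) :
    ∀ᵐ ω ∂P, (condDistrib Y C P (C ω)).map (fun y => F (C ω, y)) = condDistrib Y C P (C ω) := by
  set κ := condDistrib Y C P
  -- the kernel `c ↦ law of F (c, y)` for `y` distributed as `κ c`
  let κ' : Kernel E G := (Kernel.id ×ₖ κ).map F
  have hκ' (c : E) : κ' c = (κ c).map (fun y => F (c, y)) := by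
    rw [Kernel.map_apply _ hF, Kernel.prod_apply, Kernel.id_apply, Measure.dirac_prod,
      Measure.map_map hF (by fun_prop)]
    rfl
  have : IsFiniteKernel κ' := by
    unfold κ'
    infer_instance
  have hcomp : P.map C ⊗ₘ κ' = P.map (fun ω => (C ω, F (C ω, Y ω))) := by
    have h1 : P.map (fun ω => (C ω, F (C ω, Y ω))) =
        (P.map C ⊗ₘ κ).map (fun p => (p.1, F p)) := by
      rw [compProd_map_condDistrib hY, AEMeasurable.map_map_of_aemeasurable (by fun_prop)
        (by fun_prop)]
      rfl
    rw [h1]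
    refine Measure.ext_of_lintegral _ fun f hf => ?_
    rw [lintegral_map hf (by fun_prop), Measure.lintegral_compProd hf,
      Measure.lintegral_compProd (by fun_prop)]
    refine lintegral_congr fun c => ?_
    rw [hκ', lintegral_map (by fun_prop) (by fun_prop)]
  have hae : κ =ᵐ[P.map C] κ' :=
    condDistrib_ae_eq_of_measure_eq_compProd C hY (by rw [hcomp, h])
  filter_upwards [ae_of_ae_map hC hae] with ω hω
  rw [← hκ', ← hω]

lemma ae_memLp_two_condDistrib (hC : AEMeasurable C P) (hY : AEMeasurable Y P) {f : G → ℝ}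
    (hf : Measurable f) (h : MemLp (fun ω => f (Y ω)) 2 P) :
    ∀ᵐ ω ∂P, MemLp f 2 (condDistrib Y C P (C ω)) := by
  have hi : Integrable (fun p : E × G => f p.2 ^ 2) (P.map fun ω => (C ω, Y ω)) := by
    rw [integrable_map_measure
      (Measurable.aestronglyMeasurable (by fun_prop)) (by fun_prop)]
    exact h.integrable_sq
  filter_upwards [hi.condDistrib_ae hC hY] with ω hω
  exact (memLp_two_iff_integrable_sq hf.aestronglyMeasurable).2 hω

/-- A variable whose conditional variance given `C` vanishes is a function of `C`. -/
lemma exists_ae_eq_comp_of_variance_condDistrib_eq_zero (hC : AEMeasurable C P)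
    (hY : AEMeasurable Y P) {f : G → ℝ} (hf : Measurable f) (h : MemLp (fun ω => f (Y ω)) 2 P)
    (hv : ∀ᵐ ω ∂P, variance f (condDistrib Y C P (C ω)) = 0) :
    ∃ φ : E → ℝ, Measurable φ ∧ ∀ᵐ ω ∂P, f (Y ω) = φ (C ω) := by
  set κ := condDistrib Y C P
  let φ : E → ℝ := fun c => ∫ y, f y ∂(κ c)
  have hφ : Measurable φ := (hf.stronglyMeasurable.integral_kernel (κ := κ)).measurable
  refine ⟨φ, hφ, ?_⟩
  have hset : MeasurableSet {p : E × G | f p.2 = φ p.1} :=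
    measurableSet_eq_fun (by fun_prop) (by fun_prop)
  have hae : ∀ᵐ ω ∂P, ∀ᵐ y ∂(κ (C ω)), f y = φ (C ω) := by
    filter_upwards [hv, ae_memLp_two_condDistrib hC hY hf h] with ω h0 h2
    exact ae_eq_integral_of_variance_eq_zero h2 h0
  have hms : MeasurableSet {c | ∀ᵐ y ∂(κ c), f y = φ c} :=
    Kernel.measurable_kernel_prodMk_left hset.compl (measurableSet_singleton 0)
  have hjoint : ∀ᵐ p ∂(P.map fun ω => (C ω, Y ω)), f p.2 = φ p.1 := by
    rw [← compProd_map_condDistrib hY, Measure.ae_compProd_iff hset, ae_map_iff hC hms]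
    exact hae
  exact ae_of_ae_map (p := fun p : E × G => f p.2 = φ p.1) (by fun_prop) hjoint

/-- For a law on the plane invariant under `(u, w) ↦ (u, l - b u - w)`, the second coordinate may be
replaced by its image in the covariance. -/
lemma covariance_fst_snd_of_map_eq {ρ : Measure (ℝ × ℝ)} {l b : ℝ}
    (h : ρ.map (fun p => (p.1, l - b * p.1 - p.2)) = ρ) :
    covariance (fun p : ℝ × ℝ => p.1) (fun p => p.2) ρ =
      covariance (fun p : ℝ × ℝ => p.1) (fun p => l - b * p.1 - p.2) ρ := by
  conv_lhs => rw [← h]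
  rw [covariance_map_fun (by fun_prop) (by fun_prop) (by fun_prop)]

end Conditional

/-! ### The conditional law of a pair of coordinates -/

section Pair

variable {Ω : Type*} [MeasurableSpace Ω] {P : Measure Ω}
  {d : ℕ} {X : Ω → EuclideanSpace ℝ (Fin d)} {m : EuclideanSpace ℝ (Fin d)}
  {K : Matrix (Fin d) (Fin d) ℝ} {i j : Fin d}

lemma aemeasurable_dropPair (hX : AEMeasurable X P) : AEMeasurable (dropPair X i j) P := by
  unfold dropPair
  fun_prop

variable [IsProbabilityMeasure P]

lemma dropPair_axisReflection_left (x : EuclideanSpace ℝ (Fin d)) :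
    dropPair (axisReflection K m i) i j x = dropPair id i j x := by
  ext k
  exact axisReflection_apply_of_ne m x k.2.1

lemma dropPair_axisReflection_right (x : EuclideanSpace ℝ (Fin d)) :
    dropPair (axisReflection K m j) i j x = dropPair id i j x := by
  ext k
  exact axisReflection_apply_of_ne m x k.2.2

/-- Given `X_(ij)`, the conditional law of `(g(X_i), X_j)` is invariant under an affine
reflection in its second coordinate. The hypothesis on `b` says that the regression of `X_j` on the
other coordinates depends on `X_i` through `g(X_i)` only: it holds with `b = 0` if `K_ij = 0`, and
with `b = 2 K_ji / K_jj` if `g` is the identity. -/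
lemma IsElliptical.exists_map_condPairLaw_eq (hX : IsElliptical P X m K⁻¹) (hK : K.PosDef)
    (hij : i ≠ j) {g : ℝ → ℝ} (hg : Measurable g) {b : ℝ}
    (hb : ∀ x, 2 / K j j * (K j i * x) = b * g x) :
    ∀ᵐ ω ∂P, ∃ l : ℝ,
      (condPairLaw P (fun ω' => g (X ω' i)) (fun ω' => X ω' j) (dropPair X i j) ω).map
          (fun p => (p.1, l - b * p.1 - p.2)) =
        condPairLaw P (fun ω' => g (X ω' i)) (fun ω' => X ω' j) (dropPair X i j) ω := by
  have hXm : AEMeasurable X P := hX.1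
  have hkk : K j j ≠ 0 := hK.diag_pos.ne'
  -- the part of the reflected `j`-th coordinate that is constant given `X_(ij)`
  let L : ({k : Fin d // k ≠ i ∧ k ≠ j} → ℝ) → ℝ := fun c =>
    2 * m j + 2 / K j j * (K j i * m i) -
      2 / K j j * ∑ k : {k : Fin d // k ≠ i ∧ k ≠ j}, K j k * (c k - m k)
  have hL : Measurable L := by
    unfold L
    fun_prop
  let F : ({k : Fin d // k ≠ i ∧ k ≠ j} → ℝ) × (ℝ × ℝ) → ℝ × ℝ :=
    fun p => (p.2.1, L p.1 - b * p.2.1 - p.2.2)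
  have hF : Measurable F := by
    unfold F
    fun_prop
  let Q : EuclideanSpace ℝ (Fin d) → ({k : Fin d // k ≠ i ∧ k ≠ j} → ℝ) × (ℝ × ℝ) :=
    fun x => (dropPair id i j x, (g (x i), x j))
  have hQ : Measurable Q := by
    unfold Q dropPair
    fun_prop
  have hrefl (x : EuclideanSpace ℝ (Fin d)) :
      Q (axisReflection K m j x) = ((Q x).1, F (Q x)) := by
    have hsum : ∑ l, K j l * (x l - m l) = K j i * (x i - m i) + K j j * (x j - m j) +
        ∑ k : {k : Fin d // k ≠ i ∧ k ≠ j}, K j k * (x k - m k) := by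
      rw [← Finset.sum_subtype (Finset.univ.filter fun k => k ≠ i ∧ k ≠ j) (by simp)
          (fun k => K j k * (x k - m k)),
        ← Finset.sum_pair (f := fun l => K j l * (x l - m l)) hij,
        ← Finset.sum_union]
      · congr 1
        ext k
        simp
        tauto
      · rw [Finset.disjoint_left]
        simp
    refine Prod.ext (dropPair_axisReflection_right x) (Prod.ext ?_ ?_)
    · simp [Q, F, axisReflection_apply_of_ne m x hij]
    · simp only [Q, F, axisReflection_apply_self, L, ← hb, hsum, dropPair, id]
      field_simp
      ring
  have h := congrArg (Measure.map Q) (hX.map_axisReflection hK j)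
  have h' : P.map (fun ω => ((Q (X ω)).1, F (Q (X ω)))) = P.map (fun ω => Q (X ω)) := by
    rw [Measure.map_map hQ (by fun_prop), AEMeasurable.map_map_of_aemeasurable (by fun_prop) hXm,
      AEMeasurable.map_map_of_aemeasurable (by fun_prop) hXm] at h
    simpa only [Function.comp_def, hrefl] using h
  have hY : AEMeasurable (fun ω => (g (X ω i), X ω j)) P := by fun_prop
  filter_upwards [map_condDistrib_eq_of_map_eq (aemeasurable_dropPair hXm) hY hF h'] with ω hω
  exact ⟨L (dropPair X i j ω), hω⟩

/-- For a nondegenerate elliptical vector, `X_i` is not a function of the coordinates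
`X_(ij)`. -/
lemma IsElliptical.ae_eq_of_coord_ae_eq_comp (hX : IsElliptical P X m K⁻¹) (hK : K.PosDef)
    {f : ({k : Fin d // k ≠ i ∧ k ≠ j} → ℝ) → ℝ} (hf : Measurable f)
    (h : ∀ᵐ ω ∂P, X ω i = f (dropPair X i j ω)) : ∀ᵐ ω ∂P, X ω = m := by
  have hkk : K i i ≠ 0 := hK.diag_pos.ne'
  have hid : Measurable (dropPair (id : EuclideanSpace ℝ (Fin d) → _) i j) := by
    unfold dropPair
    fun_prop
  have hset : MeasurableSet {x : EuclideanSpace ℝ (Fin d) | x i = f (dropPair id i j x)} :=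
    measurableSet_eq_fun (by fun_prop) (by fun_prop)
  have h1 : ∀ᵐ x ∂(P.map X), x i = f (dropPair id i j x) := (ae_map_iff hX.1 hset).2 h
  have h2 := h1
  rw [← hX.map_axisReflection hK i, ae_map_iff (by fun_prop) hset] at h2
  refine hX.ae_eq_of_row_eq_zero hK i ?_
  -- the reflection along the `i`-th axis moves `x i` but not `f (dropPair id i j x)`
  filter_upwards [h1, h2] with x hx1 hx2
  have hx3 : dropPair id i j (axisReflection K m i x) = dropPair id i j x :=
    dropPair_axisReflection_left x
  rw [hx3, ← hx1, axisReflection_apply_self] at hx2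
  have : 2 / K i i * ∑ l, K i l * (x l - m l) = 0 := by linarith
  simpa [hkk] using this

end Pair

/-! ### Vanishing of the conditional covariance -/

theorem mainTheorem1 {Ω : Type*} [MeasurableSpace Ω] (P : Measure Ω) [IsProbabilityMeasure P]
    {d : ℕ} (X : Ω → EuclideanSpace ℝ (Fin d)) (m : EuclideanSpace ℝ (Fin d))
    (K : Matrix (Fin d) (Fin d) ℝ) (hK : K.PosDef)
    (hX : IsElliptical P X m K⁻¹)
    (hX_sq : MemLp X 2 P) (hX_nondeg : ¬ ∀ᵐ ω ∂P, X ω = m)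
    (i j : Fin d) (hij : i ≠ j) :
    K i j = 0 ↔
      ∀ g : ℝ → ℝ, Measurable g →
        (∀ᵐ ω ∂P, CondCovExistsAt P (fun ω' => g (X ω' i)) (fun ω' => X ω' j)
          (dropPair X i j) ω) →
        ∀ᵐ ω ∂P, condCov P (fun ω' => g (X ω' i)) (fun ω' => X ω' j) (dropPair X i j) ω = 0 := by
  have hsymm : K j i = K i j := by simpa using hK.isHermitian.apply i j
  have hXm : AEMeasurable X P := hX.1
  constructor
  · intro h0 g hg hex
    filter_upwards [hex, hX.exists_map_condPairLaw_eq hK hij hg (b := 0) (by simp [hsymm, h0])]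
      with ω hω ⟨l, hl⟩
    have : IsProbabilityMeasure
        (condPairLaw P (fun ω' => g (X ω' i)) (fun ω' => X ω' j) (dropPair X i j) ω) := by
      unfold condPairLaw
      infer_instance
    have h1 := covariance_fst_snd_of_map_eq hl
    simp only [zero_mul, sub_zero] at h1
    rw [covariance_const_sub_right hω.2.1] at h1
    unfold condCov
    linarith
  · intro h
    by_contra h0
    refine hX_nondeg ?_
    have hcoord (k : Fin d) : MemLp (fun ω => X ω k) 2 P :=
      hX_sq.mono (by fun_prop) (.of_forall fun ω => PiLp.norm_apply_le (X ω) k)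
    have hC : AEMeasurable (dropPair X i j) P := aemeasurable_dropPair hXm
    have hY : AEMeasurable (fun ω => (X ω i, X ω j)) P := by fun_prop
    have hU := ae_memLp_two_condDistrib hC hY measurable_fst (hcoord i)
    have hW := ae_memLp_two_condDistrib hC hY measurable_snd (hcoord j)
    have hkk : K j j ≠ 0 := hK.diag_pos.ne'
    have hcov := h id measurable_id (by
      filter_upwards [hU, hW] with ω h1 h2
      exact ⟨h1.integrable one_le_two, h2.integrable one_le_two, h1.integrable_mul h2⟩)
    have hvar : ∀ᵐ ω ∂P, variance Prod.fst
        (condDistrib (fun ω => (X ω i, X ω j)) (dropPair X i j) P (dropPair X i j ω)) = 0 := by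
      filter_upwards [hU, hW, hcov, hX.exists_map_condPairLaw_eq hK hij measurable_id
        (b := 2 / K j j * K j i) (by intro x; simp [mul_assoc])] with ω h1 h2 h3 ⟨l, hl⟩
      have h4 := covariance_fst_snd_of_map_eq hl
      simp only [condCov, condPairLaw, id] at h3 h4
      set ρ : Measure (ℝ × ℝ) :=
        condDistrib (fun ω => (X ω i, X ω j)) (dropPair X i j) P (dropPair X i j ω)
      set b := 2 / K j j * K j i with hb
      have hb0 : b ≠ 0 := by simp [hb, hsymm, h0, hkk]
      have hfst : MemLp (fun p : ℝ × ℝ => p.1) 2 ρ := h1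
      have hsnd : MemLp (fun p : ℝ × ℝ => p.2) 2 ρ := h2
      have hbU : MemLp (fun p : ℝ × ℝ => b * p.1) 2 ρ := h1.const_mul b
      have hlU : MemLp (fun p : ℝ × ℝ => l - b * p.1) 2 ρ := (memLp_const l).sub hbU
      rw [covariance_fun_sub_right hfst hlU hsnd,
        covariance_const_sub_right (hbU.integrable one_le_two), covariance_const_mul_right, h3,
        covariance_self hfst.aemeasurable] at h4
      have h5 : b * variance (fun p : ℝ × ℝ => p.1) ρ = 0 := by linarith
      exact (mul_eq_zero.1 h5).resolve_left hb0
    obtain ⟨f, hf, hfe⟩ :=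
      exists_ae_eq_comp_of_variance_condDistrib_eq_zero hC hY measurable_fst (hcoord i) hvar
    exact hX.ae_eq_of_coord_ae_eq_comp hK hf hfe
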